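/- All spaces are separable and metrizable, and $\dim$ denotes the (small inductive) dimension, with $\dim\varnothing=-1$. A space $X$ is almost zero-dimensional if every point of $X$ has a neighborhood basis consisting of intersections of clopen subsets of $X$. For a space $X$ let $\Lambda(X)$ be the set of points $x\in X$ at which $X$ is $1$-dimensional, that is: every neighborhood of $x$ contains an open neighborhood of $x$ whose boundary has dimension at most $0$, but not every neighborhood of $x$ contains a clopen neighborhood of $x$. A space $X$ is weakly $1$-dimensional if $\dim(X)=1$ and $\dim(\Lambda(X))=0$. Theorem. If $X$ is a separable metrizable almost zero-dimensional space with $\dim(X)\neq 0$, then $\dim(\Lambda(X))=\dim(X)$. Consequently, no separable metrizable space is both almost zero-dimensional and weakly $1$-dimensional. -/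

import Mathlib

open Set Topology TopologicalSpace

/-- A C-set in `X` is an intersection of clopen subsets of `X`. -/
def IsCSet {X : Type*} [TopologicalSpace X] (A : Set X) : Prop :=
  ∃ S : Set (Set X), (∀ C ∈ S, IsClopen C) ∧ A = ⋂₀ S

/-- `X` is almost zero-dimensional if every point has a neighborhood basis of C-sets
(the neighborhoods are not required to be open). -/
def AlmostZeroDimensional (X : Type*) [TopologicalSpace X] : Prop :=
  ∀ x : X, ∀ U ∈ 𝓝 x, ∃ A ∈ 𝓝 x, IsCSet A ∧ A ⊆ U

/-- The small inductive dimension of `X` at the point `x` is at most `n`: every neighborhood of `x`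
contains an open neighborhood of `x` whose boundary has dimension less than `n`. For `n = 0`
the boundary is empty, i.e. the open neighborhood is clopen. -/
def DimensionLEAt {X : Type*} [TopologicalSpace X] (x : X) (n : ℕ) : Prop :=
  ∀ U ∈ 𝓝 x, ∃ V : Set X, IsOpen V ∧ x ∈ V ∧ V ⊆ U ∧ HasSmallInductiveDimensionLT (frontier V) n

/-- `X` is `1`-dimensional at `x`: its dimension at `x` is at most `1` but not at most `0`. -/
def OneDimensionalAt {X : Type*} [TopologicalSpace X] (x : X) : Prop :=
  DimensionLEAt x 1 ∧ ¬ DimensionLEAt x 0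

/-- The dimensional kernel `Λ(X)`: the set of points at which `X` is `1`-dimensional. -/
def dimensionalKernel (X : Type*) [TopologicalSpace X] : Set X :=
  {x : X | OneDimensionalAt x}

/-- `X` is weakly `1`-dimensional if it has dimension `1` and its dimensional kernel, as a
subspace, has dimension `0`. -/
def WeaklyOneDimensional (X : Type*) [TopologicalSpace X] : Prop :=
  smallInductiveDimension X = 1 ∧ smallInductiveDimension (dimensionalKernel X) = 0

/-!
A C-set is a set closed in a coarser zero-dimensional topology, and in an almost zero-dimensional
space C-sets behave well in three ways, all by local finiteness off a C-set
(`IsCSet.exists_glue`): between a C-set and an open set around it there is a C-set neighborhood,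
a clopen set can be glued together around a C-set from local pieces, and a closed countable union
of C-sets is a C-set.

Fix a point `x` in an open set `U`. Interpolation yields C-sets `A 0 ⊆ A 1 ⊆ ⋯` around `x` with
open union `V`, inside a C-set `E ⊆ U`, such that the gap `E \ V`, which contains the frontier of
`V`, has countably many properties prescribed in advance (`AlmostZeroDimensional.exists_nested`).

* Prescribing that on the gap the topology agrees with the one generated by the clopen sets of the
  space makes the gap zero-dimensional. Hence the dimension is at most `1` at every point, and the
  dimensional kernel is the set of points without clopen neighborhood bases.
* The kernel is a countable union of C-sets `F n`. If it is zero-dimensional, the relatively clopen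
  subsets of `F n` are C-sets, as closed countable unions of C-sets, so one can prescribe that the
  gap misses every `F n`. The gap then consists of points with clopen neighborhood bases; clopen
  neighborhoods of these points and the sets `A n` glue to a clopen set between `E` and `U`. So the
  space is zero-dimensional.

Therefore a nonempty almost zero-dimensional space which is not zero-dimensional has dimension `1`,
and its kernel, again almost zero-dimensional, has dimension at most `1` and not at most `0`.
-/

/-! ### C-sets and gluing -/

/-- A set is a C-set iff every point outside it lies in a clopen set missing it. -/
theorem isCSet_iff {X : Type*} [TopologicalSpace X] {A : Set X} :
    IsCSet A ↔ ∀ y ∉ A, ∃ K, IsClopen K ∧ y ∈ K ∧ Disjoint K A := by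
  constructor
  · rintro ⟨S, hS, rfl⟩ y hy
    simp only [mem_sInter, not_forall] at hy
    obtain ⟨C, hC, hyC⟩ := hy
    exact ⟨Cᶜ, (hS C hC).compl, hyC, disjoint_left.2 fun z hz hz' ↦ hz (hz' C hC)⟩
  · intro h
    refine ⟨{C | IsClopen C ∧ A ⊆ C}, fun C hC ↦ hC.1, Subset.antisymm
      (subset_sInter fun C hC ↦ hC.2) fun y hy ↦ by_contra fun hyA ↦ ?_⟩
    obtain ⟨K, hK, hyK, hKA⟩ := h y hyA
    exact hy Kᶜ ⟨hK.compl, subset_compl_iff_disjoint_left.2 hKA⟩ hyK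

namespace IsCSet

variable {X : Type*} [TopologicalSpace X] {A B F : Set X}

theorem isClosed (hA : IsCSet A) : IsClosed A := by
  obtain ⟨S, hS, rfl⟩ := hA
  exact isClosed_sInter fun C hC ↦ (hS C hC).isClosed

theorem of_isClopen (hA : IsClopen A) : IsCSet A :=
  ⟨{A}, by simpa using hA, by simp⟩

theorem iInter {ι : Sort*} {A : ι → Set X} (hA : ∀ i, IsCSet (A i)) : IsCSet (⋂ i, A i) := by
  refine isCSet_iff.2 fun y hy ↦ ?_
  simp only [mem_iInter, not_forall] at hy
  obtain ⟨i, hi⟩ := hy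
  obtain ⟨K, hK, hyK, hKA⟩ := isCSet_iff.1 (hA i) y hi
  exact ⟨K, hK, hyK, hKA.mono_right (iInter_subset _ i)⟩

theorem inter (hA : IsCSet A) (hB : IsCSet B) : IsCSet (A ∩ B) := by
  rw [inter_eq_iInter]
  exact iInter (by simp [hA, hB])

theorem union (hA : IsCSet A) (hB : IsCSet B) : IsCSet (A ∪ B) := by
  refine isCSet_iff.2 fun y hy ↦ ?_
  rw [mem_union, not_or] at hy
  obtain ⟨K, hK, hyK, hKA⟩ := isCSet_iff.1 hA y hy.1
  obtain ⟨K', hK', hyK', hKB⟩ := isCSet_iff.1 hB y hy.2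
  exact ⟨K ∩ K', hK.inter hK', ⟨hyK, hyK'⟩, disjoint_union_right.2
    ⟨hKA.mono_left inter_subset_left, hKB.mono_left inter_subset_right⟩⟩

theorem biUnion_finset {ι : Type*} (s : Finset ι) {A : ι → Set X} (hA : ∀ i, IsCSet (A i)) :
    IsCSet (⋃ i ∈ s, A i) := by
  classical
  induction s using Finset.induction_on with
  | empty => simpa using of_isClopen (isClopen_empty (X := X))
  | insert a s _ ih => rw [Finset.set_biUnion_insert]; exact (hA a).union ih

theorem preimage {Y : Type*} [TopologicalSpace Y] {f : Y → X} (hf : Continuous f)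
    (hA : IsCSet A) : IsCSet (f ⁻¹' A) :=
  isCSet_iff.2 fun y hy ↦ by
    obtain ⟨K, hK, hyK, hKA⟩ := isCSet_iff.1 hA (f y) hy
    exact ⟨f ⁻¹' K, hK.preimage hf, hyK, hKA.preimage f⟩

end IsCSet

/-- Lindelöf property: a set that is locally covered by neighborhoods with property `p` is covered
by the interiors of a sequence of sets with property `p`. -/
theorem exists_seq_subset_iUnion_interior {X : Type*} [TopologicalSpace X]
    [SecondCountableTopology X] {p : Set X → Prop} (h0 : p ∅) {s : Set X}
    (h : ∀ x ∈ s, ∃ N ∈ 𝓝 x, p N) :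
    ∃ E : ℕ → Set X, (∀ n, p (E n)) ∧ s ⊆ ⋃ n, interior (E n) := by
  choose N hN hp using h
  obtain ⟨t, ht, hst⟩ := (HereditarilyLindelofSpace.isLindelof s).elim_nhds_subcover'
    (fun x hx ↦ interior (N x hx)) (fun x hx ↦ interior_mem_nhds.2 (hN x hx))
  rcases t.eq_empty_or_nonempty with rfl | hne
  · exact ⟨fun _ ↦ ∅, fun _ ↦ h0, hst.trans (by simp)⟩
  · obtain ⟨f, rfl⟩ := ht.exists_eq_range hne
    refine ⟨fun n ↦ N (f n) (f n).2, fun n ↦ hp _ _, hst.trans ?_⟩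
    rw [biUnion_range]

section CSets

variable {X : Type*} [TopologicalSpace X] [SecondCountableTopology X] {A B F : Set X}

/-- The complement of a C-set is the union of an increasing sequence of clopen sets. -/
theorem IsCSet.exists_monotone_isClopen (hA : IsCSet A) :
    ∃ G : ℕ → Set X, Monotone G ∧ (∀ n, IsClopen (G n)) ∧ ⋃ n, G n = Aᶜ := by
  obtain ⟨G, hG, hAG⟩ := exists_seq_subset_iUnion_interior
    (p := fun K ↦ IsClopen K ∧ K ⊆ Aᶜ) ⟨isClopen_empty, empty_subset _⟩ (s := Aᶜ) fun x hx ↦ by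
      obtain ⟨K, hK, hxK, hKA⟩ := isCSet_iff.1 hA x hx
      exact ⟨K, hK.isOpen.mem_nhds hxK, hK, hKA.subset_compl_right⟩
  refine ⟨accumulate G, monotone_accumulate, fun n ↦ ?_, ?_⟩
  · exact (finite_Iic n).isClopen_biUnion fun i _ ↦ (hG i).1
  · rw [iUnion_accumulate]
    exact Subset.antisymm (iUnion_subset fun i ↦ (hG i).2)
      (hAG.trans (iUnion_mono fun i ↦ interior_subset))

/-- The main gluing device. If the interiors of the C-sets `E i` cover the C-set `A`, then shrinking
`E i` to `E i \ G i`, where the clopen sets `G i` increase to `Aᶜ`, makes the family locally finite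
off `A`, so that its union is a C-set around `A`. The union is clopen once every
`E i` is open off `A`. -/
theorem IsCSet.exists_glue (hA : IsCSet A) {E : ℕ → Set X} (hE : ∀ n, IsCSet (E n))
    (hAE : A ⊆ ⋃ n, interior (E n)) :
    ∃ D, IsCSet D ∧ A ⊆ interior D ∧ D ⊆ ⋃ n, E n ∧
      ((∀ n, E n ⊆ A ∪ interior (E n)) → IsClopen D) := by
  obtain ⟨G, hGm, hG, hGA⟩ := hA.exists_monotone_isClopen
  have hmem : ∀ {y n}, y ∈ G n → y ∉ A := fun {y n} hy ↦ by
    rw [← mem_compl_iff, ← hGA]; exact mem_iUnion_of_mem n hy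
  have hint : ∀ {y n}, y ∈ interior (E n) → y ∉ G n → y ∈ interior (⋃ n, E n \ G n) :=
    fun {y n} hy hyG ↦ interior_maximal
      ((sdiff_subset_sdiff_left interior_subset).trans (subset_iUnion (fun n ↦ E n \ G n) n))
      (isOpen_interior.sdiff (hG n).isClosed) ⟨hy, hyG⟩
  have hAD : A ⊆ interior (⋃ n, E n \ G n) := fun y hy ↦ by
    obtain ⟨n, hn⟩ := mem_iUnion.1 (hAE hy)
    exact hint hn fun h ↦ hmem h hy
  have hD : IsCSet (⋃ n, E n \ G n) := by
    refine isCSet_iff.2 fun y hy ↦ ?_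
    have hyA : y ∈ ⋃ n, G n := hGA ▸ fun h ↦ hy (interior_subset (hAD h))
    obtain ⟨j, hj⟩ := mem_iUnion.1 hyA
    -- inside `G j` only the finitely many sets with index below `j` survive
    have hfin : IsCSet (⋃ i ∈ Finset.range j, E i \ G i) :=
      .biUnion_finset _ fun i ↦ (hE i).inter (.of_isClopen (hG i).compl)
    obtain ⟨K, hK, hyK, hKE⟩ := isCSet_iff.1 hfin y fun h ↦ hy <| by
      simp only [mem_iUnion] at h ⊢
      obtain ⟨i, -, hi⟩ := h
      exact ⟨i, hi⟩
    refine ⟨K ∩ G j, hK.inter (hG j), ⟨hyK, hj⟩, disjoint_left.2 fun z hz hz' ↦ ?_⟩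
    obtain ⟨i, hi⟩ := mem_iUnion.1 hz'
    have hij : i < j := not_le.1 fun hji ↦ hi.2 (hGm hji hz.2)
    exact disjoint_left.1 hKE hz.1 (mem_biUnion (Finset.mem_range.2 hij) hi)
  refine ⟨_, hD, hAD, iUnion_mono fun n ↦ sdiff_subset, fun h ↦ ⟨hD.isClosed, ?_⟩⟩
  refine isOpen_iff_mem_nhds.2 fun y hy ↦ mem_interior_iff_mem_nhds.1 ?_
  obtain ⟨n, hn⟩ := mem_iUnion.1 hy
  exact (h n hn.1).elim (fun h ↦ hAD h) fun h ↦ hint h hn.2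

theorem IsCSet.exists_isClopen_of_isClopen_nhds (hA : IsCSet A) {U : Set X}
    (h : ∀ x ∈ A, ∃ K, IsClopen K ∧ x ∈ K ∧ K ⊆ U) :
    ∃ K, IsClopen K ∧ A ⊆ K ∧ K ⊆ U := by
  obtain ⟨E, hE, hAE⟩ := exists_seq_subset_iUnion_interior (s := A)
    (p := fun K ↦ IsClopen K ∧ K ⊆ U) ⟨isClopen_empty, empty_subset _⟩ fun x hx ↦ by
      obtain ⟨K, hK, hxK, hKU⟩ := h x hx
      exact ⟨K, hK.isOpen.mem_nhds hxK, hK, hKU⟩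
  obtain ⟨D, -, hAD, hDE, hD⟩ := hA.exists_glue (fun n ↦ .of_isClopen (hE n).1) hAE
  exact ⟨D, hD fun n ↦ (hE n).1.isOpen.interior_eq.symm ▸ subset_union_right,
    hAD.trans interior_subset, hDE.trans (iUnion_subset fun n ↦ (hE n).2)⟩

theorem IsCSet.exists_isClopen_separating (hA : IsCSet A) (hB : IsCSet B) (hAB : Disjoint A B) :
    ∃ K, IsClopen K ∧ A ⊆ K ∧ Disjoint K B := by
  obtain ⟨K, hK, hAK, hKB⟩ := hA.exists_isClopen_of_isClopen_nhds (U := Bᶜ) fun x hx ↦ by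
    obtain ⟨K, hK, hxK, hKB⟩ := isCSet_iff.1 hB x (disjoint_left.1 hAB hx)
    exact ⟨K, hK, hxK, hKB.subset_compl_right⟩
  exact ⟨K, hK, hAK, disjoint_left.2 fun x hx ↦ hKB hx⟩

theorem AlmostZeroDimensional.exists_seq_isCSet (hX : AlmostZeroDimensional X) {U : Set X}
    (hU : IsOpen U) :
    ∃ E : ℕ → Set X, (∀ n, IsCSet (E n) ∧ E n ⊆ U) ∧ U ⊆ ⋃ n, interior (E n) :=
  exists_seq_subset_iUnion_interior ⟨.of_isClopen isClopen_empty, empty_subset _⟩ fun x hx ↦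
    hX x U (hU.mem_nhds hx)

/-- An interpolation property replacing normality: C-sets have C-set neighborhoods inside any
open neighborhood. -/
theorem AlmostZeroDimensional.exists_isCSet_between (hX : AlmostZeroDimensional X) {U : Set X}
    (hA : IsCSet A) (hU : IsOpen U) (hAU : A ⊆ U) :
    ∃ E, IsCSet E ∧ A ⊆ interior E ∧ E ⊆ U := by
  obtain ⟨E, hE, hUE⟩ := hX.exists_seq_isCSet hU
  obtain ⟨D, hD, hAD, hDE, -⟩ := hA.exists_glue (fun n ↦ (hE n).1) (hAU.trans hUE)
  exact ⟨D, hD, hAD, hDE.trans (iUnion_subset fun n ↦ (hE n).2)⟩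

/-- In an almost zero-dimensional space, closed countable unions of C-sets are C-sets. -/
theorem AlmostZeroDimensional.isCSet_iUnion (hX : AlmostZeroDimensional X) {A : ℕ → Set X}
    (hA : ∀ n, IsCSet (A n)) (hcl : IsClosed (⋃ n, A n)) : IsCSet (⋃ n, A n) := by
  refine isCSet_iff.2 fun y hy ↦ ?_
  obtain ⟨E, hE, hUE⟩ := hX.exists_seq_isCSet hcl.isOpen_compl
  obtain ⟨E₀, hE₀y, hE₀, hE₀A⟩ := hX y _ (hcl.isOpen_compl.mem_nhds hy)
  -- `O n` is a clopen set around `A n` missing `E₀` and `E 0, …, E n`; the sets `O n` are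
  -- therefore locally finite off the union of the `A n`
  have hO : ∀ n, ∃ O, IsClopen O ∧ A n ⊆ O ∧
      Disjoint O (E₀ ∪ ⋃ i ∈ Finset.range (n + 1), E i) := fun n ↦ by
    refine (hA n).exists_isClopen_separating
      (hE₀.union (.biUnion_finset _ fun i ↦ (hE i).1)) (disjoint_left.2 fun z hz hz' ↦ ?_)
    have hzA : z ∈ ⋃ n, A n := mem_iUnion_of_mem n hz
    rcases hz' with hz' | hz'
    · exact hE₀A hz' hzA
    · simp only [mem_iUnion] at hz'
      obtain ⟨i, -, hi⟩ := hz'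
      exact (hE i).2 hi hzA
  choose O hO hAO hOE using hO
  have hclosed : IsClosed (⋃ n, O n) := by
    refine isOpen_compl_iff.1 (isOpen_iff_mem_nhds.2 fun z hz ↦ ?_)
    have hzA : z ∈ (⋃ n, A n)ᶜ := fun h ↦ hz (iUnion_mono hAO h)
    obtain ⟨k, hk⟩ := mem_iUnion.1 (hUE hzA)
    have hfin : IsClosed (⋃ i ∈ Finset.range k, O i) :=
      isClosed_biUnion_finset fun i _ ↦ (hO i).isClosed
    have hz' : z ∈ (⋃ i ∈ Finset.range k, O i)ᶜ := fun h ↦ hz <| by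
      simp only [mem_iUnion] at h ⊢
      obtain ⟨i, -, hi⟩ := h
      exact ⟨i, hi⟩
    filter_upwards [isOpen_interior.mem_nhds hk, hfin.isOpen_compl.mem_nhds hz'] with w hw hw' h
    obtain ⟨i, hi⟩ := mem_iUnion.1 h
    rcases lt_or_ge i k with hik | hik
    · exact hw' (mem_biUnion (Finset.mem_range.2 hik) hi)
    · exact disjoint_left.1 (hOE i) hi (.inr (mem_biUnion
        (Finset.mem_range.2 (Nat.lt_succ_of_le hik)) (interior_subset hw)))
  refine ⟨(⋃ n, O n)ᶜ, ⟨(isOpen_iUnion fun n ↦ (hO n).isOpen).isClosed_compl,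
    hclosed.isOpen_compl⟩, fun h ↦ ?_, disjoint_left.2 fun z hz hz' ↦ hz (iUnion_mono hAO hz')⟩
  obtain ⟨n, hn⟩ := mem_iUnion.1 h
  exact disjoint_left.1 (hOE n) hn (.inl (mem_of_mem_nhds hE₀y))

/-- A relatively clopen part `C` of a C-set `F` is again a C-set: being relatively open, it is a
countable union of C-sets, and it is closed. -/
theorem AlmostZeroDimensional.isCSet_of_isClosed_diff (hX : AlmostZeroDimensional X)
    (hF : IsCSet F) {C : Set X} (hCF : C ⊆ F) (hC : IsClosed C) (hFC : IsClosed (F \ C)) :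
    IsCSet C := by
  obtain ⟨E, hE, hUE⟩ := hX.exists_seq_isCSet hFC.isOpen_compl
  have hCE : C = ⋃ n, F ∩ E n := by
    rw [← inter_iUnion]
    refine Subset.antisymm (fun x hx ↦ ⟨hCF hx, ?_⟩) fun x hx ↦ by_contra fun hxC ↦ ?_
    · exact iUnion_mono (fun n ↦ interior_subset) (hUE fun h ↦ h.2 hx)
    · obtain ⟨n, hn⟩ := mem_iUnion.1 hx.2
      exact (hE n).2 hn ⟨hx.1, hxC⟩
  rw [hCE] at hC ⊢
  exact hX.isCSet_iUnion (fun n ↦ hF.inter (hE n).1) hC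

/-- A countable family of pairs `P n ⊆ O n` that determines the topology, with `P n` a C-set and
`O n` open. -/
theorem AlmostZeroDimensional.exists_seq_pairs (hX : AlmostZeroDimensional X) :
    ∃ P O : ℕ → Set X, (∀ n, IsCSet (P n) ∧ IsOpen (O n) ∧ P n ⊆ O n) ∧
      ∀ x, ∀ U ∈ 𝓝 x, ∃ n, x ∈ P n ∧ O n ⊆ U := by
  have hb := isBasis_countableBasis X
  obtain ⟨b, hbr⟩ := ((countable_countableBasis X).insert ∅).exists_eq_range (insert_nonempty _ _)
  have hbo : ∀ n, IsOpen (b n) := fun n ↦ by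
    rcases hbr.superset (mem_range_self n) with h | h
    · exact h ▸ isOpen_empty
    · exact hb.isOpen h
  choose E hE hbE using fun n ↦ hX.exists_seq_isCSet (hbo n)
  refine ⟨fun n ↦ E n.unpair.1 n.unpair.2, fun n ↦ b n.unpair.1,
    fun n ↦ ⟨(hE _ _).1, hbo _, (hE _ _).2⟩, fun x U hU ↦ ?_⟩
  obtain ⟨v, hv, hxv, hvU⟩ := hb.mem_nhds_iff.1 hU
  obtain ⟨m, rfl⟩ := hbr.subset (mem_insert_of_mem ∅ hv)
  obtain ⟨k, hk⟩ := mem_iUnion.1 (hbE m hxv)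
  exact ⟨Nat.pair m k, by simpa using interior_subset hk, by simpa using hvU⟩

end CSets

/-! ### Nested sequences of C-sets -/

/-- Nested C-sets `A 0 ⊆ A 1 ⊆ ⋯ ⊆ E` around `x` with prescribed behavior on the gap `E \ ⋃ A n`.
Each property `R n` of the gap is preserved by passing to subsets and can be
forced by narrowing any pair of C-sets, one of which is interior to the other. -/
theorem AlmostZeroDimensional.exists_nested {X : Type*} [TopologicalSpace X]
    (hX : AlmostZeroDimensional X)
    {R : ℕ → Set X → Prop} (hR : ∀ n D D', D ⊆ D' → R n D' → R n D)
    (step : ∀ n A E, IsCSet A → IsCSet E → A ⊆ interior E → ∃ A' E', IsCSet A' ∧ IsCSet E' ∧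
      A ⊆ interior A' ∧ A' ⊆ interior E' ∧ E' ⊆ E ∧ R n (E' \ A'))
    {x : X} {U : Set X} (hU : U ∈ 𝓝 x) :
    ∃ (A : ℕ → Set X) (E : Set X), (∀ n, IsCSet (A n)) ∧ IsCSet E ∧
      (∀ n, A n ⊆ interior (A (n + 1))) ∧ x ∈ A 0 ∧ ⋃ n, A n ⊆ E ∧ E ⊆ U ∧
      ∀ n, R n (E \ ⋃ n, A n) := by
  obtain ⟨E₀, hxE₀, hE₀, hE₀U⟩ := hX x U hU
  obtain ⟨A₀, hxA₀, hA₀, hA₀E₀⟩ := hX x _ (interior_mem_nhds.2 hxE₀)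
  choose! f g hf hg hAf hfg hgE hfR using step
  let s : ℕ → Set X × Set X := fun n ↦
    n.rec (A₀, E₀) fun n p ↦ (f n p.1 p.2, g n p.1 p.2)
  have hs : ∀ n, IsCSet (s n).1 ∧ IsCSet (s n).2 ∧ (s n).1 ⊆ interior (s n).2 := fun n ↦ by
    induction n with
    | zero => exact ⟨hA₀, hE₀, hA₀E₀⟩
    | succ n ih =>
      obtain ⟨h₁, h₂, h₃⟩ := ih
      exact ⟨hf _ _ _ h₁ h₂ h₃, hg _ _ _ h₁ h₂ h₃, hfg _ _ _ h₁ h₂ h₃⟩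
  have hA : ∀ n, (s n).1 ⊆ interior (s (n + 1)).1 := fun n ↦
    hAf _ _ _ (hs n).1 (hs n).2.1 (hs n).2.2
  have hAm : Monotone fun n ↦ (s n).1 := monotone_nat_of_le_succ fun n ↦
    (hA n).trans interior_subset
  have hEm : Antitone fun n ↦ (s n).2 := antitone_nat_of_succ_le fun n ↦
    hgE _ _ _ (hs n).1 (hs n).2.1 (hs n).2.2
  refine ⟨fun n ↦ (s n).1, ⋂ n, (s n).2, fun n ↦ (hs n).1, .iInter fun n ↦ (hs n).2.1, hA,
    mem_of_mem_nhds hxA₀, iUnion_subset fun n ↦ subset_iInter fun m ↦ ?_,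
    (iInter_subset _ 0).trans hE₀U, fun n ↦ ?_⟩
  · calc (s n).1 ⊆ (s (max n m)).1 := hAm (le_max_left _ _)
      _ ⊆ (s (max n m)).2 := (hs _).2.2.trans interior_subset
      _ ⊆ (s m).2 := hEm (le_max_right _ _)
  · exact hR n _ _ (sdiff_subset_sdiff (iInter_subset _ (n + 1))
      (subset_iUnion (fun n ↦ (s n).1) (n + 1))) (hfR _ _ _ (hs n).1 (hs n).2.1 (hs n).2.2)

/-! ### Almost zero-dimensional spaces have dimension at most one -/

theorem AlmostZeroDimensional.subtype {X : Type*} [TopologicalSpace X]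
    (hX : AlmostZeroDimensional X) (s : Set X) : AlmostZeroDimensional s := fun x U hU ↦ by
  obtain ⟨V, hV, hVU⟩ := mem_nhds_subtype s x U |>.1 hU
  obtain ⟨A, hA, hAc, hAV⟩ := hX x V hV
  exact ⟨(↑) ⁻¹' A, continuous_subtype_val.continuousAt.preimage_mem_nhds hA, hAc.preimage continuous_subtype_val,
    (preimage_mono hAV).trans hVU⟩

theorem hasSmallInductiveDimensionLT_one_of_isClopen_nhds {X : Type*} [TopologicalSpace X]
    (h : ∀ x : X, ∀ U ∈ 𝓝 x, ∃ K, IsClopen K ∧ x ∈ K ∧ K ⊆ U) :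
    HasSmallInductiveDimensionLT X 1 :=
  hasSmallInductiveDimensionLT_one_iff.2 <| isTopologicalBasis_of_isOpen_of_nhds
    (fun _ hK ↦ hK.isOpen) fun x U hxU hU ↦ by
      obtain ⟨K, hK, hxK, hKU⟩ := h x U (hU.mem_nhds hxU)
      exact ⟨K, hK, hxK, hKU⟩

theorem dimensionLEAt_zero_iff {X : Type*} [TopologicalSpace X] {x : X} :
    DimensionLEAt x 0 ↔ ∀ U ∈ 𝓝 x, ∃ K, IsClopen K ∧ x ∈ K ∧ K ⊆ U := by
  simp only [DimensionLEAt, hasSmallInductiveDimensionLT_zero_iff, isEmpty_coe_sort,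
    ← isClopen_iff_frontier_eq_empty]
  exact forall₂_congr fun U _ ↦ exists_congr fun V ↦
    ⟨fun h ↦ ⟨h.2.2.2, h.2.1, h.2.2.1⟩, fun h ↦ ⟨h.1.isOpen, h.2.1, h.2.2, h.1⟩⟩

theorem hasSmallInductiveDimensionLT_succ_of_dimensionLEAt {X : Type*} [TopologicalSpace X]
    {n : ℕ} (h : ∀ x : X, DimensionLEAt x n) : HasSmallInductiveDimensionLT X (n + 1) := by
  refine .succ n {V | IsOpen V ∧ HasSmallInductiveDimensionLT (frontier V) n}
    (isTopologicalBasis_of_isOpen_of_nhds (fun _ hV ↦ hV.1) fun x U hxU hU ↦ ?_)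
    fun V hV ↦ hV.2
  obtain ⟨V, hV, hxV, hVU, hVn⟩ := h x U (hU.mem_nhds hxU)
  exact ⟨V, ⟨hV, hVn⟩, hxV, hVU⟩

/-- Given a pair `P ⊆ O`, the gap `E' \ A'` is arranged so that its points in `P` have clopen
neighborhoods meeting the gap inside `O`. Doing this for all pairs of a family that determines
the topology makes the final gap, hence the frontier of `⋃ A n`, zero-dimensional. -/
theorem AlmostZeroDimensional.dimensionLEAt_one {X : Type*} [TopologicalSpace X]
    [SecondCountableTopology X] (hX : AlmostZeroDimensional X) (x : X) : DimensionLEAt x 1 := by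
  intro U hU
  obtain ⟨P, O, hPO, hbasis⟩ := hX.exists_seq_pairs
  obtain ⟨A, E, hA, hE, hAA, hxA, hAE, hEU, hR⟩ := hX.exists_nested
    (R := fun n D ↦ ∀ z ∈ P n ∩ D, ∃ K, IsClopen K ∧ z ∈ K ∧ K ∩ D ⊆ O n)
    (fun n D D' hD h z hz ↦ by
      obtain ⟨K, hK, hzK, hKO⟩ := h z ⟨hz.1, hD hz.2⟩
      exact ⟨K, hK, hzK, (inter_subset_inter_right K hD).trans hKO⟩)
    (fun n A E hA hE hAE ↦ by
      obtain ⟨Q, hQ, hPQ, hQO⟩ := hX.exists_isCSet_between (hPO n).1 (hPO n).2.1 (hPO n).2.2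
      obtain ⟨B, hB, hAB, hBE⟩ := hX.exists_isCSet_between hA isOpen_interior hAE
      obtain ⟨M, hM, hBM, hME⟩ := hX.exists_isCSet_between hB isOpen_interior hBE
      -- the gap lies outside `M` on `P n`, and inside `M` off `Q`
      refine ⟨B ∪ (M ∩ P n), M ∪ (E ∩ Q), hB.union (hM.inter (hPO n).1), hM.union (hE.inter hQ),
        hAB.trans (interior_mono subset_union_left), union_subset
          (hBM.trans (interior_mono subset_union_left)) ?_, union_subset
          (hME.trans interior_subset) inter_subset_left, fun z hz ↦ ?_⟩
      · refine (inter_subset_inter hME hPQ).trans ?_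
        rw [← interior_inter]
        exact interior_mono subset_union_right
      · obtain ⟨K, hK, hzK, hKM⟩ := isCSet_iff.1 hM z fun h ↦ hz.2.2 (.inr ⟨h, hz.1⟩)
        refine ⟨K, hK, hzK, fun w hw ↦ ?_⟩
        exact hQO (hw.2.1.resolve_left (disjoint_left.1 hKM hw.1)).2)
    hU
  have hVo : IsOpen (⋃ n, A n) := isOpen_iff_mem_nhds.2 fun y hy ↦ by
    obtain ⟨n, hn⟩ := mem_iUnion.1 hy
    exact Filter.mem_of_superset (mem_interior_iff_mem_nhds.1 (hAA n hn)) (subset_iUnion A (n + 1))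
  have hfr : frontier (⋃ n, A n) ⊆ E \ ⋃ n, A n := by
    rw [hVo.frontier_eq]
    exact sdiff_subset_sdiff_left (closure_minimal hAE hE.isClosed)
  refine ⟨⋃ n, A n, hVo, mem_iUnion_of_mem 0 hxA, hAE.trans hEU,
    hasSmallInductiveDimensionLT_one_of_isClopen_nhds fun z W hW ↦ ?_⟩
  obtain ⟨W', hW', hWW⟩ := mem_nhds_subtype _ z W |>.1 hW
  obtain ⟨n, hzn, hnW⟩ := hbasis z W' hW'
  obtain ⟨K, hK, hzK, hKO⟩ := hR n z ⟨hzn, hfr z.2⟩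
  exact ⟨Subtype.val ⁻¹' K, hK.preimage continuous_subtype_val, hzK, fun w hw ↦
    hWW (hnW (hKO ⟨hw, hfr w.2⟩))⟩

/-! ### Zero-dimensionality of the dimensional kernel -/

theorem HasSmallInductiveDimensionLT.exists_isClopen {X : Type*} [TopologicalSpace X]
    (h : HasSmallInductiveDimensionLT X 1) {x : X} {U : Set X} (hU : U ∈ 𝓝 x) :
    ∃ K, IsClopen K ∧ x ∈ K ∧ K ⊆ U :=
  (hasSmallInductiveDimensionLT_one_iff.1 h).mem_nhds_iff.1 hU

/-- In a subspace `F` lying in a zero-dimensional subspace `s`, closed sets have relatively clopen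
neighborhoods inside any neighborhood. Here `F` is closed in the whole space. -/
theorem exists_clopen_partition_of_subset {X : Type*} [TopologicalSpace X]
    [SecondCountableTopology X] {s F A U : Set X} (hs : HasSmallInductiveDimensionLT s 1)
    (hFs : F ⊆ s) (hF : IsClosed F) (hA : IsClosed A) (hU : IsOpen U) (hAU : A ⊆ U) :
    ∃ C ⊆ F, IsClosed C ∧ IsClosed (F \ C) ∧ A ∩ F ⊆ C ∧ C ⊆ U := by
  have hclopen : ∀ (x : F) (V : Set F), V ∈ 𝓝 x → ∃ K, IsClopen K ∧ x ∈ K ∧ K ⊆ V := by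
    intro x V hV
    obtain ⟨W, hW, hWV⟩ := mem_nhds_subtype F x V |>.1 hV
    obtain ⟨K, hK, hxK, hKW⟩ := hs.exists_isClopen (x := inclusion hFs x)
      (continuous_subtype_val.continuousAt hW)
    exact ⟨inclusion hFs ⁻¹' K, hK.preimage (continuous_inclusion hFs), hxK, fun y hy ↦
      hWV (hKW hy)⟩
  have hAc : IsCSet ((↑) ⁻¹' A : Set F) := isCSet_iff.2 fun y hy ↦ by
    obtain ⟨K, hK, hyK, hKA⟩ := hclopen y _
      ((hA.preimage continuous_subtype_val).isOpen_compl.mem_nhds hy)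
    exact ⟨K, hK, hyK, disjoint_left.2 fun z hz ↦ hKA hz⟩
  obtain ⟨K, hK, hAK, hKU⟩ := hAc.exists_isClopen_of_isClopen_nhds (U := (↑) ⁻¹' U)
    fun x hx ↦ hclopen x _ ((hU.preimage continuous_subtype_val).mem_nhds (hAU hx))
  refine ⟨(↑) '' K, by simp, hF.isClosedEmbedding_subtypeVal.isClosedMap _ hK.isClosed, ?_,
    fun y hy ↦ ⟨⟨y, hy.2⟩, hAK hy.1, rfl⟩, image_subset_iff.2 hKU⟩
  have hdiff : F \ (↑) '' K = (↑) '' Kᶜ := by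
    ext y
    simp +contextual
  rw [hdiff]
  exact hF.isClosedEmbedding_subtypeVal.isClosedMap _ hK.compl.isClosed

/-- The points without clopen neighborhood bases form a countable union of C-sets. -/
theorem AlmostZeroDimensional.exists_seq_isCSet_iUnion_eq {X : Type*} [TopologicalSpace X]
    [SecondCountableTopology X] (hX : AlmostZeroDimensional X) :
    ∃ F : ℕ → Set X, (∀ n, IsCSet (F n)) ∧ ⋃ n, F n = {x : X | ¬ DimensionLEAt x 0} := by
  obtain ⟨P, O, hPO, hbasis⟩ := hX.exists_seq_pairs
  refine ⟨fun n ↦ P n ∩ {x | ∀ K, IsClopen K → K ⊆ O n → x ∉ K}, fun n ↦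
    (hPO n).1.inter (isCSet_iff.2 fun y hy ↦ ?_), ?_⟩
  · simp only [mem_ofPred_eq, not_forall, not_not] at hy
    obtain ⟨K, hK, hKO, hyK⟩ := hy
    exact ⟨K, hK, hyK, disjoint_left.2 fun z hz hz' ↦ hz' K hK hKO hz⟩
  · ext x
    rw [mem_iUnion, mem_ofPred_eq, dimensionLEAt_zero_iff]
    constructor
    · rintro ⟨n, hxP, hx⟩ h
      obtain ⟨K, hK, hxK, hKO⟩ := h _ ((hPO n).2.1.mem_nhds ((hPO n).2.2 hxP))
      exact hx K hK hKO hxK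
    · intro h
      push Not at h
      obtain ⟨U, hU, hx⟩ := h
      obtain ⟨n, hxP, hOU⟩ := hbasis x U hU
      exact ⟨n, hxP, fun K hK hKO hxK ↦ hx K hK hxK (hKO.trans hOU)⟩

/-- If the points without clopen neighborhood bases form a zero-dimensional subspace, there are
none. The gap `E \ ⋃ A n` can be made to avoid all of them, so it is covered by clopen sets
inside `U`, and gluing these with the sets `A n` gives a clopen neighborhood inside `U`. -/
theorem AlmostZeroDimensional.dimensionLEAt_zero {X : Type*} [TopologicalSpace X]
    [SecondCountableTopology X] (hX : AlmostZeroDimensional X)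
    (h : HasSmallInductiveDimensionLT {x : X | ¬ DimensionLEAt x 0} 1) (x : X) :
    DimensionLEAt x 0 := by
  refine dimensionLEAt_zero_iff.2 fun U hU ↦ ?_
  obtain ⟨F, hF, hFU⟩ := hX.exists_seq_isCSet_iUnion_eq
  obtain ⟨A, E, hA, hE, hAA, hxA, hAE, hEU, hR⟩ := hX.exists_nested
    (R := fun n D ↦ Disjoint (F n) D) (fun n D D' hD h ↦ h.mono_right hD)
    (fun n A E hA hE hAE ↦ by
      obtain ⟨C, hCF, hC, hFC, hAC, hCE⟩ := exists_clopen_partition_of_subset h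
        ((subset_iUnion F n).trans hFU.subset) (hF n).isClosed hA.isClosed isOpen_interior hAE
      have hCc := hX.isCSet_of_isClosed_diff (hF n) hCF hC hFC
      obtain ⟨E', hE', hAE', hEE'⟩ := hX.exists_isCSet_between (hA.union hCc)
        (isOpen_interior.sdiff hFC) (subset_sdiff.2 ⟨union_subset hAE hCE,
          disjoint_left.2 fun y hy hy' ↦ hy'.2 (hy.elim (fun h ↦ hAC ⟨h, hy'.1⟩) id)⟩)
      obtain ⟨A', hA', hAA', hAE''⟩ :=
        hX.exists_isCSet_between (hA.union hCc) isOpen_interior hAE'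
      refine ⟨A', E', hA', hE', subset_union_left.trans hAA', hAE'',
        (hEE'.trans sdiff_subset).trans interior_subset, disjoint_left.2 fun y hy hy' ↦ hy'.2 ?_⟩
      have hyC : y ∈ C := by_contra fun hyC ↦ (hEE' hy'.1).2 ⟨hy, hyC⟩
      exact interior_subset (hAA' (.inr hyC)))
    (interior_mem_nhds.2 hU)
  obtain ⟨K, hK, hEK⟩ := exists_seq_subset_iUnion_interior (s := E \ ⋃ n, A n)
    (p := fun K ↦ IsClopen K ∧ K ⊆ U) ⟨isClopen_empty, empty_subset _⟩ fun z hz ↦ by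
      have hz0 : DimensionLEAt z 0 := by_contra fun hz0 ↦ by
        obtain ⟨n, hn⟩ := mem_iUnion.1 (hFU.superset hz0)
        exact disjoint_left.1 (hR n) hn hz
      obtain ⟨K, hK, hzK, hKU⟩ := dimensionLEAt_zero_iff.1 hz0 U
        (mem_interior_iff_mem_nhds.1 (hEU hz.1))
      exact ⟨K, hK.isOpen.mem_nhds hzK, hK, hKU⟩
  obtain ⟨D, -, hED, hDU, hD⟩ := hE.exists_glue (E := fun n ↦ A n ∪ K n)
    (fun n ↦ (hA n).union (.of_isClopen (hK n).1)) fun z hz ↦ by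
      by_cases hzA : z ∈ ⋃ n, A n
      · obtain ⟨n, hn⟩ := mem_iUnion.1 hzA
        exact mem_iUnion_of_mem (n + 1) (interior_mono subset_union_left (hAA n hn))
      · obtain ⟨n, hn⟩ := mem_iUnion.1 (hEK ⟨hz, hzA⟩)
        exact mem_iUnion_of_mem n (interior_mono subset_union_right hn)
  refine ⟨D, hD fun n ↦ union_subset (((subset_iUnion A n).trans hAE).trans subset_union_left)
    ?_, interior_subset (hED (hAE (mem_iUnion_of_mem 0 hxA))), hDU.trans (iUnion_subset fun n ↦
      union_subset (((subset_iUnion A n).trans hAE).trans (hEU.trans interior_subset)) (hK n).2)⟩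
  exact (interior_maximal subset_union_right (hK n).1.isOpen).trans subset_union_right

theorem AlmostZeroDimensional.dimensionalKernel_eq {X : Type*} [TopologicalSpace X]
    [SecondCountableTopology X] (hX : AlmostZeroDimensional X) :
    dimensionalKernel X = {x : X | ¬ DimensionLEAt x 0} := by
  ext x
  exact and_iff_right (hX.dimensionLEAt_one x)

theorem AlmostZeroDimensional.smallInductiveDimension_dimensionalKernel {X : Type*}
    [TopologicalSpace X] [SecondCountableTopology X] (hX : AlmostZeroDimensional X)
    (h0 : smallInductiveDimension X ≠ 0) :
    smallInductiveDimension (dimensionalKernel X) = smallInductiveDimension X := by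
  rcases isEmpty_or_nonempty X with hemp | hne
  · simp
  have hX1 : ¬ HasSmallInductiveDimensionLT X 1 := fun h ↦
    h0 (smallInductiveDimension_eq 0 h (by simp))
  have hΛ1 : ¬ HasSmallInductiveDimensionLT (dimensionalKernel X) 1 := fun h ↦ by
    rw [hX.dimensionalKernel_eq] at h
    exact hX1 (hasSmallInductiveDimensionLT_succ_of_dimensionLEAt (hX.dimensionLEAt_zero h))
  rw [smallInductiveDimension_eq 1 (hasSmallInductiveDimensionLT_succ_of_dimensionLEAt
      hX.dimensionLEAt_one) hX1,
    smallInductiveDimension_eq 1 (hasSmallInductiveDimensionLT_succ_of_dimensionLEAt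
      (hX.subtype _).dimensionLEAt_one) hΛ1]

theorem theorem1 (X : Type*) [TopologicalSpace X] [MetrizableSpace X] [SeparableSpace X] :
    (AlmostZeroDimensional X → smallInductiveDimension X ≠ 0 →
      smallInductiveDimension (dimensionalKernel X) = smallInductiveDimension X) ∧
    ¬ (AlmostZeroDimensional X ∧ WeaklyOneDimensional X) := by
  have : SecondCountableTopology X := by
    let := metrizableSpaceMetric X
    exact UniformSpace.secondCountable_of_separable X
  refine ⟨fun hX h0 ↦ hX.smallInductiveDimension_dimensionalKernel h0, fun ⟨hX, h1, h0⟩ ↦ ?_⟩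
  have h := hX.smallInductiveDimension_dimensionalKernel (by simp [h1])
  simp [h0, h1] at h
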